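/- **Setting.** Let $(\mathbf X,\mathfrak X)$ be a measurable space, $\mathbf A$ a Borel space (a space homeomorphic to a Borel subset of a Polish space) with its Borel $\sigma$-algebra, $\mathbf A(x)\subseteq\mathbf A$ ($x\in\mathbf X$) nonempty sets such that $\mathbf K=\{(x,a): a\in\mathbf A(x)\}$ is measurable in $\mathbf X\times\mathbf A$, $Q$ a stochastic kernel on $\mathbf X$ given $\mathbf X\times\mathbf A$, $\eta$ a probability measure on $\mathbf X$ and $\Delta\in\mathfrak X$. A policy $\pi\in\mathbf\Pi$ is a sequence of stochastic kernels $\pi_n$ on $\mathbf A$ given $\mathbf H_n=(\mathbf X\times\mathbf A)^n\times\mathbf X$ with $\pi_n(\mathbf A(x_n)\mid h_n)=1$ for all $n\ge 0$ and $h_n=(x_0,a_0,\dots,x_n)\in\mathbf H_n$. Let $\mathbb P_{\eta,\pi}$ be the law on $(\mathbf X\times\mathbf A)^\infty$ of the state-action process $(X_n,A_n)_{n\ge0}$ with $X_0\sim\eta$, in which $A_n$ has conditional law $\pi_n(\cdot\mid H_n)$ given $H_n=(X_0,A_0,\dots,X_n)$, and $X_{n+1}$ has conditional law $Q(\cdot\mid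 X_n,A_n)$ given $(H_n,A_n)$. Let $T_\Delta=\min\{n\ge0: X_n\in\Delta\}$, with $\min\emptyset=\infty$. Let $\mathbf M$ be the set of stochastic kernels $\varphi$ on $\mathbf A$ given $\mathbf X$ with $\varphi(\mathbf A(x)\mid x)=1$ for all $x$, and for $\varphi\in\mathbf M$ let $Q_\varphi(B\mid x)=\int_{\mathbf A}Q(B\mid x,a)\,\varphi(da\mid x)$; let $Q_\varphi^k$ be its $k$-fold composition with itself ($Q_\varphi^0$ the identity kernel). *Occupation measures.* The occupation measure of $\pi\in\mathbf\Pi$ is $$\mu_{\eta,\pi}(\Gamma)=\mathbb E_{\eta,\pi}\Big[\sum_{t\ge0}\mathbf 1_{\{T_\Delta>t\}}\mathbf 1_{\{(X_t,A_t)\in\Gamma\}}\Big]\qquad(\Gamma\subseteq\mathbf X\times\mathbf A\text{ measurable}),$$ and $\mathcal O_\eta=\{\mu_{\eta,\pi}:\pi\in\mathbf\Pi\}$. *Characteristic equations.* $\mathcal C_\eta$ is the set of finite measures $\mu$ on $\mathbf X\times\mathbf A$ such that $\mu(\mathbf K^c)=0$ and $$\mu^{\mathbf X}(B)=\eta(B\setminus\Delta)+\int_{\mathbf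 X\times\mathbf A} Q(B\setminus\Delta\mid x,a)\,\mu(dx,da)\qquad(B\in\mathfrak X),$$ where $\mu^{\mathbf X}$ is the marginal of $\mu$ on $\mathbf X$. **Assumptions.** The model is absorbing: $Q(\Delta\mid x,a)=1$ for all $(x,a)\in\Delta\times\mathbf A$, and $\mathbb E_{\eta,\pi}[T_\Delta]<\infty$ for every $\pi\in\mathbf\Pi$. Condition (S) holds: $\mathbf A$ is compact; every $\mathbf A(x)$ is nonempty and compact; $\{x:\mathbf A(x)\cap U\neq\emptyset\}\in\mathfrak X$ for every open $U\subseteq\mathbf A$; and $a\mapsto Q(\Gamma\mid x,a)$ is continuous on $\mathbf A$ for all $x\in\mathbf X$ and $\Gamma\in\mathfrak X$. **Theorem.** There exists a dominating $\xi^*\in\mathbf M$, that is, one with $Q(\cdot\mid x,a)\ll Q_{\xi^*}(\cdot\mid x)$ for every $(x,a)\in\mathbf K$. Moreover, for every dominating $\xi^*\in\mathbf M$ and every $0<\beta<1$, let $$\lambda^\beta=(1-\beta)\sum_{k\ge0}\beta^k\,\eta Q_{\xi^*}^k .$$ Then for every $\mu\in\mathcal C_\eta$, $$\mu\in\mathcal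 O_\eta\iff\mu^{\mathbf X}\ll\lambda^\beta .$$ -/

import Mathlib

open MeasureTheory ProbabilityTheory
open scoped ENNReal

/-- The data `(X, A, {A(x)}, Q)` of a controlled Markov model: a measurable state space `X`, an
action space `A`, nonempty sets `A(x)` of available actions whose graph is measurable (hence each
`A(x)` is measurable), and a stochastic kernel `Q` on `X` given `X × A`. -/
structure ControlModel (X A : Type*) [MeasurableSpace X] [MeasurableSpace A] where
  /-- the set `A(x)` of actions available in the state `x` -/
  admissible : X → Set A
  admissible_nonempty : ∀ x, (admissible x).Nonempty
  measurableSet_graph : MeasurableSet {p : X × A | p.2 ∈ admissible p.1}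
  /-- the transition kernel `Q(dy | x, a)` -/
  Q : Kernel (X × A) X
  markov_Q : IsMarkovKernel Q

/-- The space `H_n = (X × A)^n × X` of histories `(x₀, a₀, …, x_{n-1}, a_{n-1}, x_n)`. -/
abbrev History (X A : Type*) (n : ℕ) : Type _ := (Fin n → X × A) × X

namespace ControlModel

attribute [instance] ControlModel.markov_Q

section Defs

variable {X A : Type*} [MeasurableSpace X] [MeasurableSpace A]

/-- The set `K` of feasible state-action pairs. -/
def graph (M : ControlModel X A) : Set (X × A) := {p | p.2 ∈ M.admissible p.1}

/-- A control policy: stochastic kernels `π_n` on `A` given `H_n` with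
`π_n(A(x_n) | h_n) = 1` for every history `h_n = (x₀, a₀, …, x_n)`. -/
structure Policy (M : ControlModel X A) where
  kernel : (n : ℕ) → Kernel (History X A n) A
  markov : ∀ n, IsMarkovKernel (kernel n)
  admissible : ∀ n (h : History X A n), kernel n h (M.admissible h.2) = 1

/-- The set of stochastic kernels `φ` on `A` given `X` with `φ(A(x) | x) = 1` for all `x`; each of
them generates a stationary randomized policy. -/
structure StationaryPolicy (M : ControlModel X A) where
  kernel : Kernel X A
  markov : IsMarkovKernel kernel
  admissible : ∀ x, kernel x (M.admissible x) = 1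

attribute [instance] Policy.markov StationaryPolicy.markov

/-- The law `η(dx) π₀(da | x)` of `(X₀, A₀)`. -/
noncomputable def initialLaw (M : ControlModel X A) (η : Measure X) (π : M.Policy) :
    Measure (X × A) :=
  η ⊗ₘ (π.kernel 0).comap (fun x : X => ((Fin.elim0, x) : History X A 0)) (by fun_prop)

/-- The history `(x₀, a₀, …, x_n, a_n, y)` in `H_{n+1}` obtained by appending the state `y` to the
state-action pairs up to time `n`. -/
def appendState (n : ℕ) (p : ((_ : Finset.Iic n) → X × A) × X) : History X A (n + 1) :=
  (fun i => p.1 ⟨i, Finset.mem_Iic.2 (Nat.lt_succ_iff.1 i.2)⟩, p.2)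

lemma measurable_appendState (n : ℕ) : Measurable (appendState (X := X) (A := A) n) := by
  unfold appendState
  fun_prop

/-- The conditional law of `(X_{n+1}, A_{n+1})` given `(x₀, a₀, …, x_n, a_n)`, which is
`Q(dy | x_n, a_n) π_{n+1}(db | x₀, a₀, …, x_n, a_n, y)`. -/
noncomputable def stepKernel (M : ControlModel X A) (π : M.Policy) (n : ℕ) :
    Kernel ((_ : Finset.Iic n) → X × A) (X × A) :=
  (M.Q.comap (fun z : (_ : Finset.Iic n) → X × A => z ⟨n, Finset.mem_Iic.2 le_rfl⟩)
      (by fun_prop)) ⊗ₖ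
    ((π.kernel (n + 1)).comap (appendState n) (measurable_appendState n))

instance (M : ControlModel X A) (π : M.Policy) (n : ℕ) : IsMarkovKernel (M.stepKernel π n) := by
  unfold stepKernel
  infer_instance

/-- The law of the state-action process on the canonical space `(X × A)^∞` under the policy `π` and
the initial distribution `η`, obtained from the Ionescu-Tulcea theorem. -/
noncomputable def processLaw (M : ControlModel X A) (η : Measure X) (π : M.Policy) :
    Measure (ℕ → X × A) :=
  Kernel.trajMeasure (X := fun _ => X × A) (M.initialLaw η π) (M.stepKernel π)

/-- The hitting time `T_Δ = min {n ≥ 0 : x_n ∈ Δ}`, equal to `∞` if `Δ` is never visited. -/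
noncomputable def hittingTime (Δ : Set X) (ω : ℕ → X × A) : ℕ∞ :=
  ⨅ (n : ℕ) (_ : (ω n).1 ∈ Δ), (n : ℕ∞)

/-- The model with initial distribution `η` is absorbing to `Δ`: the set `Δ` is closed under `Q`,
and the expected hitting time of `Δ` is finite under every policy. -/
def IsAbsorbing (M : ControlModel X A) (η : Measure X) (Δ : Set X) : Prop :=
  (∀ x ∈ Δ, ∀ a : A, M.Q (x, a) Δ = 1) ∧
    ∀ π : M.Policy, ∫⁻ ω, (hittingTime Δ ω : ℝ≥0∞) ∂(M.processLaw η π) < ∞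

/-- The occupation measure `Γ ↦ E_{η,π} [∑_t 1{T_Δ > t} 1{(X_t, A_t) ∈ Γ}]`; see
`occupationMeasure_apply`. -/
noncomputable def occupationMeasure (M : ControlModel X A) (η : Measure X) (Δ : Set X)
    (π : M.Policy) : Measure (X × A) :=
  Measure.sum fun t : ℕ =>
    ((M.processLaw η π).restrict {ω | (t : ℕ∞) < hittingTime Δ ω}).map (fun ω => ω t)

lemma lt_hittingTime_iff {X A : Type*} (Δ : Set X) (ω : ℕ → X × A) (t : ℕ) :
    (t : ℕ∞) < hittingTime Δ ω ↔ ∀ n ≤ t, (ω n).1 ∉ Δ := by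
  constructor
  · intro h n hn hmem
    have h1 : hittingTime Δ ω ≤ (n : ℕ∞) := iInf₂_le n hmem
    have h2 : (n : ℕ∞) ≤ t := by exact_mod_cast hn
    exact absurd h (not_lt.2 (h1.trans h2))
  · intro h
    have h1 : ((t + 1 : ℕ) : ℕ∞) ≤ hittingTime Δ ω := by
      refine le_iInf₂ fun n hn => ?_
      by_contra hlt
      have h2 : n < t + 1 := by exact_mod_cast not_le.1 hlt
      exact h n (Nat.lt_succ_iff.1 h2) hn
    exact lt_of_lt_of_le (by exact_mod_cast Nat.lt_succ_self t) h1

lemma measurableSet_lt_hittingTime {Δ : Set X} (hΔ : MeasurableSet Δ) (t : ℕ) :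
    MeasurableSet {ω : ℕ → X × A | (t : ℕ∞) < hittingTime Δ ω} := by
  simp only [lt_hittingTime_iff, Set.ofPred_forall]
  exact MeasurableSet.iInter fun n => MeasurableSet.iInter fun _ =>
    ((measurable_fst.comp (measurable_pi_apply n)) hΔ).compl

lemma occupationMeasure_apply (M : ControlModel X A) (η : Measure X) {Δ : Set X}
    (hΔ : MeasurableSet Δ) (π : M.Policy) {Γ : Set (X × A)} (hΓ : MeasurableSet Γ) :
    M.occupationMeasure η Δ π Γ =
      ∫⁻ ω, ∑' t : ℕ, {ω' : ℕ → X × A | (t : ℕ∞) < hittingTime Δ ω'}.indicator 1 ω *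
        {ω' : ℕ → X × A | ω' t ∈ Γ}.indicator 1 ω ∂(M.processLaw η π) := by
  have hm (t : ℕ) : MeasurableSet {ω' : ℕ → X × A | ω' t ∈ Γ} := measurable_pi_apply t hΓ
  rw [occupationMeasure, Measure.sum_apply _ hΓ, lintegral_tsum]
  · refine tsum_congr fun t => ?_
    rw [Measure.map_apply (measurable_pi_apply t) hΓ,
      Measure.restrict_apply (measurable_pi_apply t hΓ), Set.inter_comm]
    change M.processLaw η π ({ω | (t : ℕ∞) < hittingTime Δ ω} ∩ {ω' | ω' t ∈ Γ}) = _
    rw [← lintegral_indicator_one ((measurableSet_lt_hittingTime hΔ t).inter (hm t)),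
      Set.inter_indicator_one]
    rfl
  · intro t
    exact ((measurable_one.indicator (measurableSet_lt_hittingTime hΔ t)).mul
      (measurable_one.indicator (hm t))).aemeasurable

/-- The set of all occupation measures. -/
def occupationMeasures (M : ControlModel X A) (η : Measure X) (Δ : Set X) :
    Set (Measure (X × A)) :=
  Set.range (M.occupationMeasure η Δ)

/-- The set of finite measures `μ` on `X × A` that solve the characteristic equations
`μ(K^c) = 0` and `μ^X = (η + μ Q) 𝕀_{Δ^c}`. -/
def characteristicSolutions (M : ControlModel X A) (η : Measure X) (Δ : Set X) :
    Set (Measure (X × A)) :=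
  {μ | IsFiniteMeasure μ ∧ μ M.graphᶜ = 0 ∧ μ.fst = (η + μ.bind M.Q).restrict Δᶜ}

/-- The kernel `Q_φ(B | x) = ∫ Q(B | x, a) φ(da | x)`; see `stationaryKernel_apply`. -/
noncomputable def stationaryKernel (M : ControlModel X A) (φ : M.StationaryPolicy) : Kernel X X :=
  M.Q ∘ₖ (Kernel.id ×ₖ φ.kernel)

lemma stationaryKernel_apply (M : ControlModel X A) (φ : M.StationaryPolicy) (x : X) {B : Set X}
    (hB : MeasurableSet B) :
    M.stationaryKernel φ x B = ∫⁻ a, M.Q (x, a) B ∂(φ.kernel x) := by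
  rw [stationaryKernel, Kernel.comp_apply' _ _ _ hB,
    Kernel.lintegral_id_prod (Kernel.measurable_coe _ hB)]

/-- `ξ` is dominating: `Q(· | x, a) ≪ Q_ξ(· | x)` for all feasible `(x, a)`. -/
def IsDominating (M : ControlModel X A) (ξ : M.StationaryPolicy) : Prop :=
  ∀ x, ∀ a ∈ M.admissible x, M.Q (x, a) ≪ M.stationaryKernel ξ x

/-- The measure `λ^β = (1 - β) ∑_k β^k η Q_ξ^k`; the power is that of the composition of kernels. -/
noncomputable def discountedLaw (M : ControlModel X A) (η : Measure X) (ξ : M.StationaryPolicy)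
    (β : ℝ) : Measure X :=
  ENNReal.ofReal (1 - β) •
    Measure.sum fun k : ℕ => ENNReal.ofReal (β ^ k) • η.bind (M.stationaryKernel ξ ^ k)

/-- The continuity-compactness conditions: the action space is compact, `x ↦ A(x)` is a weakly
measurable correspondence with nonempty compact values, and `a ↦ Q(Γ | x, a)` is continuous for
every state `x` and every measurable `Γ`. -/
structure ConditionS [TopologicalSpace A] (M : ControlModel X A) : Prop where
  compactSpace : CompactSpace A
  weaklyMeasurable : ∀ U : Set A, IsOpen U → MeasurableSet {x | (M.admissible x ∩ U).Nonempty}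
  nonempty : ∀ x, (M.admissible x).Nonempty
  isCompact : ∀ x, IsCompact (M.admissible x)
  continuous : ∀ (x : X) (Γ : Set X), MeasurableSet Γ → Continuous fun a => M.Q (x, a) Γ

end Defs

end ControlModel

/-! A dominating policy randomizes, with positive weights, over a countable dense family of
measurable selections of `A(x)`: a set that is null under `Q(· | x, f_n(x))` for all `n` is null for
every `a ∈ A(x)`, by continuity in `a`.

If `ξ` is dominating, induction on `t` shows that under any policy the law of `X_t` is absolutely
continuous with respect to `η Q_ξ^t` (`fst_pairLaw_absolutelyContinuous`). Summing over `t` gives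
the direct implication.

Conversely, disintegrate `μ = ν ⊗ φ` with `φ` stationary. Iterating the characteristic equation
gives, off `Δ`, `ν = ∑_{t<n} η Q_φ^t + ν Q_φ^n`, so `μ` is the occupation measure of `φ` once the
remainder vanishes. The danger is mass circulating off `Δ` among states that cannot be reached from
`η`. Playing `ξ` for `k` steps and then `φ` is a policy, hence has finite expected hitting time; so
`φ` spends finite expected time off `Δ` from `η Q_ξ^k`-almost every state (`ae_tsum_pow_ne_top`).
Absolute continuity carries this over to `ν`-almost every state, and dominated convergence removes
the remainder. -/

/-! ### Measurable selections -/

open Filter Topology in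
/-- The Kuratowski–Ryll-Nardzewski selection theorem. -/
theorem exists_measurable_selection {X Y : Type*} [MeasurableSpace X] [PseudoMetricSpace Y]
    [CompleteSpace Y] [SecondCountableTopology Y] [MeasurableSpace Y] [BorelSpace Y]
    {F : X → Set Y} (hc : ∀ x, IsClosed (F x)) (hne : ∀ x, (F x).Nonempty)
    (hm : ∀ U : Set Y, IsOpen U → MeasurableSet {x | (F x ∩ U).Nonempty}) :
    ∃ f : X → Y, Measurable f ∧ ∀ x, f x ∈ F x := by
  classical
  rcases isEmpty_or_nonempty X with hX | ⟨⟨x₀⟩⟩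
  · exact ⟨fun x => (hX.false x).elim, measurable_of_empty _, fun x => (hX.false x).elim⟩
  have : Nonempty Y := (hne x₀).to_type
  obtain ⟨d, hd⟩ := TopologicalSpace.exists_dense_seq Y
  have find (G : X → Set Y) (hG : ∀ x, (G x).Nonempty)
      (hGm : ∀ U : Set Y, IsOpen U → MeasurableSet {x | (G x ∩ U).Nonempty}) (r : ℝ) (hr : 0 < r) :
      ∃ j : X → ℕ, Measurable j ∧ ∀ x, (G x ∩ Metric.ball (d (j x)) r).Nonempty := by
    have hex (x : X) : ∃ n, (G x ∩ Metric.ball (d n) r).Nonempty := by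
      obtain ⟨y, hy⟩ := hG x
      obtain ⟨n, hn⟩ := hd.exists_dist_lt y hr
      exact ⟨n, y, hy, hn⟩
    exact ⟨fun x => Nat.find (hex x), measurable_find hex fun n => hGm _ Metric.isOpen_ball,
      fun x => Nat.find_spec (hex x)⟩
  let r : ℕ → ℝ := fun k => (1 / 2 : ℝ) ^ k
  have hr (k : ℕ) : 0 < r k := by positivity
  let S (k : ℕ) := {i : X → ℕ // Measurable i ∧ ∀ x, (F x ∩ Metric.ball (d (i x)) (r k)).Nonempty}
  -- The next ball must meet `F x` inside the current ball; this forces successive centres to be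
  -- close. The smaller correspondence stays weakly measurable because the current index takes
  -- countably many values.
  have next (k : ℕ) (i : S k) : ∃ j : S (k + 1), ∀ x,
      (F x ∩ Metric.ball (d (i.1 x)) (r k) ∩ Metric.ball (d (j.1 x)) (r (k + 1))).Nonempty := by
    obtain ⟨j, hj, hj'⟩ := find (fun x => F x ∩ Metric.ball (d (i.1 x)) (r k)) i.2.2
      (fun U hU => by
        have : {x | (F x ∩ Metric.ball (d (i.1 x)) (r k) ∩ U).Nonempty} =
            ⋃ n, i.1 ⁻¹' {n} ∩ {x | (F x ∩ (Metric.ball (d n) (r k) ∩ U)).Nonempty} := by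
          ext x; simp [Set.inter_assoc]
        rw [this]
        exact MeasurableSet.iUnion fun n => (i.2.1 (measurableSet_singleton n)).inter
          (hm _ (Metric.isOpen_ball.inter hU))) (r (k + 1)) (hr _)
    exact ⟨⟨j, hj, fun x => (hj' x).mono fun y hy => ⟨hy.1.1, hy.2⟩⟩, hj'⟩
  choose nx hnx using next
  obtain ⟨i₀, hi₀, hi₀'⟩ := find F hne hm (r 0) (hr 0)
  let s : (k : ℕ) → S k := fun k => Nat.rec ⟨i₀, hi₀, hi₀'⟩ (fun k i => nx k i) k
  have hs (k : ℕ) (x : X) : (F x ∩ Metric.ball (d ((s k).1 x)) (r k) ∩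
      Metric.ball (d ((s (k + 1)).1 x)) (r (k + 1))).Nonempty := hnx k (s k) x
  have hdist (x : X) (k : ℕ) :
      dist (d ((s k).1 x)) (d ((s (k + 1)).1 x)) ≤ 2 * (1 / 2 : ℝ) ^ k := by
    obtain ⟨y, ⟨_, hy⟩, hy'⟩ := hs k x
    have h1 := dist_triangle_left (d ((s k).1 x)) (d ((s (k + 1)).1 x)) y
    rw [Metric.mem_ball] at hy hy'
    have h2 : r (k + 1) = r k / 2 := by simp only [r]; ring
    have h3 := hr k
    change _ ≤ 2 * r k
    linarith
  have hlim (x : X) : ∃ y, Tendsto (fun k => d ((s k).1 x)) atTop (𝓝 y) :=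
    cauchySeq_tendsto_of_complete (cauchySeq_of_le_geometric _ _ (by norm_num) (hdist x))
  choose f hf using hlim
  refine ⟨f, measurable_of_tendsto_metrizable
    (fun k => (measurable_from_nat (f := d)).comp (s k).2.1) (tendsto_pi_nhds.2 hf), fun x => ?_⟩
  -- The centres need not lie in `F x`, but nearby points of `F x` have the same limit.
  choose z hz using fun k => (s k).2.2 x
  refine (hc x).mem_of_tendsto (b := atTop) (f := z) ?_ (Eventually.of_forall fun k => (hz k).1)
  refine (hf x).congr_dist (squeeze_zero (fun _ => dist_nonneg) (fun k => ?_)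
    (tendsto_pow_atTop_nhds_zero_of_lt_one (r := (1 / 2 : ℝ)) (by norm_num) (by norm_num)))
  rw [dist_comm]
  exact (Metric.mem_ball.1 (hz k).2).le

/-- A weakly measurable correspondence with nonempty closed values in a Polish space has a Castaing
representation. -/
theorem exists_measurable_dense_selections {X Y : Type*} [MeasurableSpace X] [PseudoMetricSpace Y]
    [CompleteSpace Y] [SecondCountableTopology Y] [MeasurableSpace Y] [BorelSpace Y]
    {F : X → Set Y} (hc : ∀ x, IsClosed (F x)) (hne : ∀ x, (F x).Nonempty)
    (hm : ∀ U : Set Y, IsOpen U → MeasurableSet {x | (F x ∩ U).Nonempty}) :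
    ∃ f : ℕ → X → Y, (∀ n, Measurable (f n)) ∧ (∀ n x, f n x ∈ F x) ∧
      ∀ x, F x ⊆ closure (Set.range fun n => f n x) := by
  classical
  obtain ⟨b, hbc, -, hb⟩ := TopologicalSpace.exists_countable_basis Y
  -- The closure makes the values closed, and it preserves weak measurability since an open set
  -- meets a set exactly when it meets its closure.
  have key (U : Set Y) (hU : IsOpen U) : ∃ f : X → Y, Measurable f ∧ (∀ x, f x ∈ F x) ∧
      ∀ x, (F x ∩ U).Nonempty → f x ∈ closure U := by
    have hmU := hm U hU
    obtain ⟨f, hf, hf'⟩ := exists_measurable_selection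
      (F := fun x => if (F x ∩ U).Nonempty then closure (F x ∩ U) else F x)
      (fun x => by split_ifs <;> [exact isClosed_closure; exact hc x])
      (fun x => by split_ifs with h <;> [exact h.closure; exact hne x])
      (fun V hV => by
        have : {x | ((if (F x ∩ U).Nonempty then closure (F x ∩ U) else F x) ∩ V).Nonempty} =
            {x | (F x ∩ (U ∩ V)).Nonempty} ∪
              ({x | (F x ∩ U).Nonempty}ᶜ ∩ {x | (F x ∩ V).Nonempty}) := by
          ext x
          by_cases h : (F x ∩ U).Nonempty
          · simp [h, closure_inter_open_nonempty_iff hV, Set.inter_assoc]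
          · have h' : ¬ (F x ∩ (U ∩ V)).Nonempty := fun h1 =>
              h (h1.mono fun y hy => ⟨hy.1, hy.2.1⟩)
            simp [h, h']
        rw [this]
        exact (hm _ (hU.inter hV)).union (hmU.compl.inter (hm _ hV)))
    refine ⟨f, hf, fun x => ?_, fun x hx => ?_⟩
    · have := hf' x
      split_ifs at this
      · exact closure_minimal Set.inter_subset_left (hc x) this
      · exact this
    · have := hf' x
      rw [if_pos hx] at this
      exact closure_mono Set.inter_subset_right this
  -- Adding the whole space makes the family nonempty, so that it can be enumerated by `ℕ`.
  have hbe : (insert Set.univ b).Nonempty := Set.insert_nonempty _ _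
  obtain ⟨U, hU⟩ := (hbc.insert Set.univ).exists_eq_range hbe
  have hUo (n : ℕ) : IsOpen (U n) := by
    have : U n ∈ insert Set.univ b := hU ▸ Set.mem_range_self n
    rcases this with h | h
    · rw [h]; exact isOpen_univ
    · exact hb.isOpen h
  choose f hf hfF hfU using fun n => key (U n) (hUo n)
  refine ⟨f, hf, hfF, fun x y hy => mem_closure_iff.2 fun V hV hyV => ?_⟩
  -- Regularity compensates for the selections lying only in the closure of a basic set.
  obtain ⟨W, hW, hyW, hWV⟩ := hb.exists_closure_subset (hV.mem_nhds hyV)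
  obtain ⟨n, rfl⟩ : W ∈ Set.range U := hU ▸ Set.mem_insert_of_mem _ hW
  exact ⟨f n x, hWV (hfU n x ⟨y, hy, hyW⟩), n, rfl⟩

/-! ### Existence of a dominating policy -/

namespace ControlModel

variable {X A : Type*} [MeasurableSpace X] [MeasurableSpace A]

lemma measurableSet_admissible (M : ControlModel X A) (x : X) : MeasurableSet (M.admissible x) :=
  measurable_prodMk_left M.measurableSet_graph

theorem ConditionS.exists_isDominating [TopologicalSpace A] [TopologicalSpace.MetrizableSpace A]
    [SecondCountableTopology A] [BorelSpace A] {M : ControlModel X A} (hS : M.ConditionS) :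
    ∃ ξ : M.StationaryPolicy, M.IsDominating ξ := by
  have := hS.compactSpace
  let := TopologicalSpace.metrizableSpaceMetric A
  obtain ⟨f, hf, hfA, hfd⟩ := exists_measurable_dense_selections
    (fun x => (hS.isCompact x).isClosed) hS.nonempty hS.weaklyMeasurable
  -- Any probability measure charging every integer would do.
  let p : Measure ℕ := poissonMeasure 1
  have hp (n : ℕ) : p {n} ≠ 0 := by
    simp [p, poissonMeasure_singleton]
    positivity
  have hfm : Measurable fun q : X × ℕ => f q.2 q.1 := measurable_from_prod_countable_left hf
  let κ : Kernel X A := (Kernel.id ×ₖ Kernel.const X p).map fun q => f q.2 q.1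
  have hκ (x : X) : κ x = p.map (fun n => f n x) := by
    simp only [κ]
    rw [Kernel.map_apply _ hfm, Kernel.prod_apply, Kernel.id_apply, Kernel.const_apply,
      Measure.dirac_prod, Measure.map_map hfm (by fun_prop)]
    rfl
  have hfx (x : X) : Measurable fun n => f n x := measurable_from_nat
  refine ⟨⟨κ, Kernel.IsMarkovKernel.map _ hfm, fun x => ?_⟩, fun x a ha => ?_⟩
  · rw [hκ, Measure.map_apply (hfx x) (M.measurableSet_admissible x)]
    rw [show (fun n => f n x) ⁻¹' M.admissible x = Set.univ from
      Set.eq_univ_of_forall fun n => hfA n x, measure_univ]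
  · refine Measure.AbsolutelyContinuous.mk fun B hB h0 => ?_
    rw [stationaryKernel_apply _ _ _ hB, hκ, lintegral_map
      (f := fun a => M.Q (x, a) B) ((Kernel.measurable_coe _ hB).comp measurable_prodMk_left) (hfx x),
      lintegral_eq_zero_iff measurable_from_nat] at h0
    have h1 : Set.range (fun n => f n x) ⊆ {a | M.Q (x, a) B = 0} := by
      rintro _ ⟨n, rfl⟩
      exact ae_iff_of_countable.1 h0 n (hp n)
    exact closure_minimal h1 (isClosed_singleton.preimage (hS.continuous x B hB)) (hfd x ha)

end ControlModel

/-! ### One-time laws of the state-action process -/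

namespace ControlModel

lemma _root_.ENat.toENNReal_eq_tsum (m : ℕ∞) :
    (m : ℝ≥0∞) = ∑' t : ℕ, if (t : ℕ∞) < m then 1 else 0 := by
  cases m with
  | top => simp
  | coe n =>
    rw [tsum_eq_sum (s := Finset.range n) fun t ht => if_neg (by simpa using ht)]
    rw [Finset.sum_congr rfl fun t ht => if_pos (by simpa using ht)]
    simp

variable {X A : Type*} [MeasurableSpace X] [MeasurableSpace A]
  (M : ControlModel X A) (η : Measure X)

instance [IsProbabilityMeasure η] (π : M.Policy) : IsProbabilityMeasure (M.initialLaw η π) := by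
  unfold initialLaw
  infer_instance

instance [IsProbabilityMeasure η] (π : M.Policy) : IsProbabilityMeasure (M.processLaw η π) := by
  unfold processLaw
  infer_instance

/-- The law of the state-action pair `(X_t, A_t)`. -/
noncomputable def pairLaw (π : M.Policy) (t : ℕ) : Measure (X × A) :=
  (M.processLaw η π).map fun ω => ω t

instance [IsProbabilityMeasure η] (π : M.Policy) (t : ℕ) :
    IsProbabilityMeasure (M.pairLaw η π t) :=
  Measure.isProbabilityMeasure_map (measurable_pi_apply t).aemeasurable

lemma pairLaw_zero (π : M.Policy) : M.pairLaw η π 0 = M.initialLaw η π := by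
  let e : ((_ : Finset.Iic 0) → X × A) → X × A := fun z => z ⟨0, Finset.mem_Iic.2 le_rfl⟩
  have he : Measurable e := measurable_pi_apply _
  have h1 : (fun ω : ℕ → X × A => ω 0) = e ∘ Preorder.frestrictLe (π := fun _ => X × A) 0 := rfl
  rw [pairLaw, processLaw, h1, ← Measure.map_map he (by fun_prop), Kernel.trajMeasure,
    Measure.map_comp _ _ (by fun_prop), Kernel.traj_map_frestrictLe, Kernel.partialTraj_self,
    Measure.id_comp, Measure.map_map he (by fun_prop)]
  exact Measure.map_id

/-- The joint law of the history up to time `n` and the pair `(X_{n+1}, A_{n+1})`. -/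
lemma lintegral_processLaw_succ [IsProbabilityMeasure η] (π : M.Policy) (n : ℕ)
    {g : ((_ : Finset.Iic n) → X × A) → X × A → ℝ≥0∞} (hg : Measurable (Function.uncurry g)) :
    ∫⁻ ω, g (Preorder.frestrictLe (π := fun _ => X × A) n ω) (ω (n + 1)) ∂(M.processLaw η π) =
      ∫⁻ ω, ∫⁻ y, ∫⁻ a, g (Preorder.frestrictLe (π := fun _ => X × A) n ω) (y, a)
        ∂(π.kernel (n + 1) (appendState n (Preorder.frestrictLe (π := fun _ => X × A) n ω, y)))
        ∂(M.Q (ω n)) ∂(M.processLaw η π) := by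
  have h := Kernel.map_frestrictLe_trajMeasure_compProd_eq_map_trajMeasure
    (X := fun _ => X × A) (μ₀ := M.initialLaw η π) (κ := M.stepKernel π) (a := n)
  have h2 := congrArg (fun m => ∫⁻ q, Function.uncurry g q ∂m) h
  change ∫⁻ q, Function.uncurry g q ∂((M.processLaw η π).map _ ⊗ₘ _) =
    ∫⁻ q, Function.uncurry g q ∂((M.processLaw η π).map _) at h2
  rw [lintegral_map hg (by fun_prop), Measure.lintegral_compProd hg,
    lintegral_map (by fun_prop) (by fun_prop)] at h2
  refine h2.symm.trans (lintegral_congr fun ω => ?_)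
  rw [stepKernel, Kernel.lintegral_compProd _ _ _ (by fun_prop)]
  rfl

lemma fst_pairLaw_succ [IsProbabilityMeasure η] (π : M.Policy) (n : ℕ) :
    (M.pairLaw η π (n + 1)).fst = (M.pairLaw η π n).bind M.Q := by
  ext B hB
  have h := M.lintegral_processLaw_succ η π n (g := fun _ q => B.indicator 1 q.1)
    ((measurable_one.indicator hB).comp (by fun_prop))
  simp only [lintegral_const, measure_univ, mul_one, lintegral_indicator_one hB] at h
  rw [Measure.bind_apply hB M.Q.aemeasurable, pairLaw, pairLaw,
    lintegral_map (Kernel.measurable_coe _ hB) (by fun_prop), ← h,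
    Measure.fst, Measure.map_map (by fun_prop) (by fun_prop), ← lintegral_indicator_one hB,
    lintegral_map (measurable_one.indicator hB) (by fun_prop)]
  rfl

lemma pairLaw_compl_graph [IsProbabilityMeasure η] (π : M.Policy) (n : ℕ) :
    M.pairLaw η π n M.graphᶜ = 0 := by
  have hK : MeasurableSet M.graphᶜ := M.measurableSet_graph.compl
  cases n with
  | zero =>
    rw [pairLaw_zero, initialLaw, Measure.compProd_apply hK]
    simp only [Kernel.comap_apply]
    refine lintegral_eq_zero_of_ae_eq_zero (Filter.Eventually.of_forall fun x => ?_)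
    exact (prob_compl_eq_zero_iff (M.measurableSet_admissible x)).2 (π.admissible 0 (_, x))
  | succ n =>
    have h := M.lintegral_processLaw_succ η π n (g := fun _ q => M.graphᶜ.indicator 1 q)
      ((measurable_one.indicator hK).comp (by fun_prop))
    rw [pairLaw, ← lintegral_indicator_one hK, lintegral_map (measurable_one.indicator hK)
      (by fun_prop), h]
    refine lintegral_eq_zero_of_ae_eq_zero (Filter.Eventually.of_forall fun ω => ?_)
    refine lintegral_eq_zero_of_ae_eq_zero (Filter.Eventually.of_forall fun y => ?_)
    have h1 (a : A) : M.graphᶜ.indicator (1 : X × A → ℝ≥0∞) (y, a) =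
      (M.admissible y)ᶜ.indicator 1 a := rfl
    simp only [h1]
    rw [lintegral_indicator_one (M.measurableSet_admissible y).compl]
    exact (prob_compl_eq_zero_iff (M.measurableSet_admissible y)).2 (π.admissible _ (_, y))

/-- A state in an absorbing set is a.s. followed by a state in that set. -/
lemma ae_mem_succ_of_mem [IsProbabilityMeasure η] {Δ : Set X} (hΔ : MeasurableSet Δ)
    (hcl : ∀ x ∈ Δ, ∀ a : A, M.Q (x, a) Δ = 1) (π : M.Policy) :
    ∀ᵐ ω ∂(M.processLaw η π), ∀ n, (ω n).1 ∈ Δ → (ω (n + 1)).1 ∈ Δ := by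
  refine ae_all_iff.2 fun n => ?_
  let e : ((_ : Finset.Iic n) → X × A) → X := fun z => (z ⟨n, Finset.mem_Iic.2 le_rfl⟩).1
  have he : Measurable e := by fun_prop
  -- The integrand is the indicator of leaving `Δ` between times `n` and `n + 1`.
  have h := M.lintegral_processLaw_succ η π n
    (g := fun z q => (Δ.indicator 1 (e z) : ℝ≥0∞) * Δᶜ.indicator 1 q.1)
    (((measurable_one.indicator hΔ).comp (he.comp measurable_fst)).mul
      ((measurable_one.indicator hΔ.compl).comp (by fun_prop)))
  have h0 : ∫⁻ ω, (Δ.indicator 1 (ω n).1 : ℝ≥0∞) * Δᶜ.indicator 1 (ω (n + 1)).1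
      ∂(M.processLaw η π) = 0 := by
    refine h.trans (lintegral_eq_zero_of_ae_eq_zero (Filter.Eventually.of_forall fun ω => ?_))
    simp only [lintegral_const, measure_univ, mul_one]
    rw [lintegral_const_mul _ (measurable_one.indicator hΔ.compl),
      lintegral_indicator_one hΔ.compl]
    by_cases hω : (ω n).1 ∈ Δ
    · rw [(prob_compl_eq_zero_iff hΔ).2 (hcl _ hω _), mul_zero]
      rfl
    · have : e (Preorder.frestrictLe (π := fun _ => X × A) n ω) ∉ Δ := hω
      simp [this]
  rw [lintegral_eq_zero_iff (f := fun ω : ℕ → X × A => (Δ.indicator 1 (ω n).1 : ℝ≥0∞) *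
    Δᶜ.indicator 1 (ω (n + 1)).1) (((measurable_one.indicator hΔ).comp (by fun_prop)).mul
      ((measurable_one.indicator hΔ.compl).comp (by fun_prop)))] at h0
  filter_upwards [h0] with ω hω h1
  by_contra h2
  simp [h1, h2] at hω

/-- Since `Δ` is almost surely never left, being outside it at time `t` rules out earlier visits.
Hitting times and occupation measures thus depend only on one-time laws. -/
lemma lt_hittingTime_ae_eq [IsProbabilityMeasure η] {Δ : Set X} (hΔ : MeasurableSet Δ)
    (hcl : ∀ x ∈ Δ, ∀ a : A, M.Q (x, a) Δ = 1) (π : M.Policy) (t : ℕ) :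
    {ω | (t : ℕ∞) < hittingTime Δ ω} =ᵐ[M.processLaw η π] {ω | (ω t).1 ∈ Δᶜ} := by
  refine Filter.eventuallyEq_set.2 ?_
  filter_upwards [M.ae_mem_succ_of_mem η hΔ hcl π] with ω hω
  simp only [lt_hittingTime_iff]
  refine ⟨fun h => h t le_rfl, fun h n hn hmem => h ?_⟩
  exact Nat.le_induction hmem (fun m _ hm => hω m hm) t hn

lemma occupationMeasure_eq_sum [IsProbabilityMeasure η] {Δ : Set X} (hΔ : MeasurableSet Δ)
    (hcl : ∀ x ∈ Δ, ∀ a : A, M.Q (x, a) Δ = 1) (π : M.Policy) :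
    M.occupationMeasure η Δ π =
      Measure.sum fun t => (M.pairLaw η π t).restrict (Prod.fst ⁻¹' Δᶜ) := by
  unfold occupationMeasure
  congr 1
  ext1 t
  rw [Measure.restrict_congr_set (M.lt_hittingTime_ae_eq η hΔ hcl π t), pairLaw,
    Measure.restrict_map (by fun_prop) (measurable_fst hΔ.compl)]
  rfl

lemma lintegral_hittingTime [IsProbabilityMeasure η] {Δ : Set X} (hΔ : MeasurableSet Δ)
    (hcl : ∀ x ∈ Δ, ∀ a : A, M.Q (x, a) Δ = 1) (π : M.Policy) :
    ∫⁻ ω, (hittingTime Δ ω : ℝ≥0∞) ∂(M.processLaw η π) =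
      ∑' t, (M.pairLaw η π t).fst Δᶜ := by
  have h1 (ω : ℕ → X × A) : (hittingTime Δ ω : ℝ≥0∞) =
      ∑' t : ℕ, {ω' : ℕ → X × A | (t : ℕ∞) < hittingTime Δ ω'}.indicator 1 ω := by
    simp only [Set.indicator_apply, Set.mem_ofPred_eq, Pi.one_apply]
    exact ENat.toENNReal_eq_tsum _
  simp_rw [h1]
  rw [lintegral_tsum fun t =>
    (measurable_one.indicator (measurableSet_lt_hittingTime hΔ t)).aemeasurable]
  refine tsum_congr fun t => ?_
  rw [lintegral_indicator_one (measurableSet_lt_hittingTime hΔ t),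
    measure_congr (M.lt_hittingTime_ae_eq η hΔ hcl π t), pairLaw, Measure.fst,
    Measure.map_map (by fun_prop) (by fun_prop), Measure.map_apply (by fun_prop) hΔ.compl]
  rfl

variable {M} in
/-- The Markov policy that uses `σ t` at time `t`. -/
noncomputable def markovPolicy (σ : ℕ → M.StationaryPolicy) : M.Policy where
  kernel n := (σ n).kernel.comap Prod.snd measurable_snd
  markov _ := inferInstance
  admissible n h := (σ n).admissible h.2

/-- The rule at time `n` reads only the current state, so the rest of the history integrates out. -/
lemma pairLaw_markovPolicy [IsProbabilityMeasure η] (σ : ℕ → M.StationaryPolicy) (n : ℕ) :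
    M.pairLaw η (markovPolicy σ) n =
      (M.pairLaw η (markovPolicy σ) n).fst ⊗ₘ (σ n).kernel := by
  cases n with
  | zero =>
    have h : M.initialLaw η (markovPolicy σ) = η ⊗ₘ (σ 0).kernel := rfl
    rw [pairLaw_zero, h, Measure.fst_compProd]
  | succ n =>
    ext B hB
    have h := M.lintegral_processLaw_succ η (markovPolicy σ) n (g := fun _ q => B.indicator 1 q)
      ((measurable_one.indicator hB).comp (by fun_prop))
    have hm : Measurable fun y => (σ (n + 1)).kernel y (Prod.mk y ⁻¹' B) :=
      Kernel.measurable_kernel_prodMk_left hB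
    rw [fst_pairLaw_succ, Measure.compProd_apply hB,
      Measure.lintegral_bind M.Q.aemeasurable hm.aemeasurable, pairLaw, pairLaw,
      lintegral_map hm.lintegral_kernel (by fun_prop), ← lintegral_indicator_one hB,
      lintegral_map (measurable_one.indicator hB) (by fun_prop), h]
    refine lintegral_congr fun ω => lintegral_congr fun y => ?_
    exact lintegral_indicator_one (measurable_prodMk_left hB)

end ControlModel

/-! ### Iterated kernels and the characteristic equation -/

lemma ProbabilityTheory.Kernel.isMarkovKernel_pow {X : Type*} [MeasurableSpace X] (κ : Kernel X X)
    [IsMarkovKernel κ] (n : ℕ) : IsMarkovKernel (κ ^ n) := by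
  induction n with
  | zero => exact inferInstanceAs (IsMarkovKernel Kernel.id)
  | succ n ih => exact inferInstanceAs (IsMarkovKernel ((κ ^ n) ∘ₖ κ))

lemma MeasureTheory.Measure.bind_kernel_pow_succ {X : Type*} [MeasurableSpace X] (m : Measure X)
    (κ : Kernel X X) (n : ℕ) : m.bind ⇑(κ ^ (n + 1)) = (m.bind ⇑(κ ^ n)).bind κ := by
  rw [pow_succ']
  exact Measure.comp_assoc.symm

lemma MeasureTheory.Measure.bind_kernel_pow_succ' {X : Type*} [MeasurableSpace X] (m : Measure X)
    (κ : Kernel X X) (n : ℕ) : m.bind ⇑(κ ^ (n + 1)) = (m.bind κ).bind ⇑(κ ^ n) := by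
  rw [pow_succ]
  exact Measure.comp_assoc.symm

lemma MeasureTheory.Measure.bind_kernel_pow_zero {X : Type*} [MeasurableSpace X] (m : Measure X)
    (κ : Kernel X X) : m.bind ⇑(κ ^ 0) = m :=
  Measure.id_comp

lemma MeasureTheory.Measure.restrict_compProd {X Y : Type*} [MeasurableSpace X]
    [MeasurableSpace Y] (m : Measure X) [SFinite m] (κ : Kernel X Y) [IsSFiniteKernel κ] {s : Set X}
    (hs : MeasurableSet s) : m.restrict s ⊗ₘ κ = (m ⊗ₘ κ).restrict (Prod.fst ⁻¹' s) := by
  ext B hB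
  rw [Measure.restrict_apply hB, Measure.compProd_apply hB,
    Measure.compProd_apply (hB.inter (measurable_fst hs)), ← lintegral_indicator hs]
  refine lintegral_congr fun x => ?_
  by_cases hx : x ∈ s <;> simp [hx, ← Set.preimage_comp, Function.comp_def]

/-- If a set is absorbing for `κ`, it is absorbing for the iterates of `κ`. -/
lemma ProbabilityTheory.Kernel.pow_apply_compl_eq_zero {X : Type*} [MeasurableSpace X]
    (κ : Kernel X X) {Δ : Set X} (hΔ : MeasurableSet Δ) (hcl : ∀ x ∈ Δ, κ x Δᶜ = 0) (n : ℕ) {x : X}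
    (hx : x ∈ Δ) : (κ ^ n) x Δᶜ = 0 := by
  induction n with
  | zero =>
    change Kernel.id x Δᶜ = 0
    simp [Kernel.id_apply, hΔ.compl, hx]
  | succ n ih =>
    rw [Kernel.pow_succ_apply_eq_lintegral _ _ _ hΔ.compl]
    refine lintegral_eq_zero_of_ae_eq_zero ?_
    have : ∀ᵐ y ∂((κ ^ n) x), y ∈ Δ := ih
    filter_upwards [this] with y hy using hcl y hy

/-- A solution of `ν = (η + ν κ)` off `Δ` is the sum of the first `n` laws of the chain and a
remainder. -/
lemma MeasureTheory.Measure.apply_eq_sum_add_bind_pow {X : Type*} [MeasurableSpace X]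
    (κ : Kernel X X) {Δ : Set X} (hΔ : MeasurableSet Δ) (hcl : ∀ x ∈ Δ, κ x Δᶜ = 0)
    {η ν : Measure X} (hν : ν = (η + ν.bind κ).restrict Δᶜ) {B : Set X} (hB : MeasurableSet B)
    (hBΔ : B ⊆ Δᶜ) (n : ℕ) :
    ν B = ∑ t ∈ Finset.range n, (η.bind ⇑(κ ^ t)) B + (ν.bind ⇑(κ ^ n)) B := by
  induction n with
  | zero => rw [Measure.bind_kernel_pow_zero, Finset.sum_range_zero, zero_add]
  | succ n ih =>
    -- Dropping the restriction to `Δᶜ` costs nothing: from `Δ` the chain cannot reach `B ⊆ Δᶜ`.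
    have h : (ν.bind ⇑(κ ^ n)) B = (η.bind ⇑(κ ^ n)) B + (ν.bind ⇑(κ ^ (n + 1))) B := by
      rw [Measure.bind_kernel_pow_succ', ← Measure.add_apply, ← Measure.comp_add,
        Measure.bind_apply hB (κ ^ n).aemeasurable, Measure.bind_apply hB (κ ^ n).aemeasurable]
      conv_lhs => rw [hν]
      rw [← lintegral_indicator hΔ.compl]
      refine lintegral_congr fun x => ?_
      by_cases hx : x ∈ Δ
      · simp [hx, measure_mono_null hBΔ (κ.pow_apply_compl_eq_zero hΔ hcl n hx)]
      · simp [hx]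
    rw [ih, h, Finset.sum_range_succ, add_assoc]

open Filter Topology in
/-- If from `ν`-almost every state the chain spends a finite expected time off `Δ`, then a solution
of `ν = (η + ν κ)` off `Δ` is the sum of the laws of the chain started from `η`. -/
lemma MeasureTheory.Measure.eq_sum_bind_pow {X : Type*} [MeasurableSpace X]
    (κ : Kernel X X) [IsMarkovKernel κ] {Δ : Set X} (hΔ : MeasurableSet Δ)
    (hcl : ∀ x ∈ Δ, κ x Δᶜ = 0) {η ν : Measure X} [IsFiniteMeasure ν]
    (hν : ν = (η + ν.bind κ).restrict Δᶜ) (hfin : ∀ᵐ x ∂ν, ∑' n, (κ ^ n) x Δᶜ ≠ ∞) :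
    ν = Measure.sum fun t => (η.bind ⇑(κ ^ t)).restrict Δᶜ := by
  have := κ.isMarkovKernel_pow
  -- The terms of a convergent series tend to zero, and the bound `1` is integrable because `ν` is
  -- finite.
  have hlim : Tendsto (fun n => (ν.bind ⇑(κ ^ n)) Δᶜ) atTop (𝓝 0) := by
    simp_rw [fun n : ℕ => Measure.bind_apply (m := ν) hΔ.compl (κ ^ n).aemeasurable]
    rw [← lintegral_zero (μ := ν)]
    refine tendsto_lintegral_of_dominated_convergence (fun _ => 1)
      (fun n => Kernel.measurable_coe _ hΔ.compl)
      (fun n => Eventually.of_forall fun x => prob_le_one) (by simp) ?_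
    filter_upwards [hfin] with x hx using ENNReal.tendsto_atTop_zero_of_tsum_ne_top hx
  have main {B : Set X} (hB : MeasurableSet B) (hBΔ : B ⊆ Δᶜ) :
      ν B = ∑' t, (η.bind ⇑(κ ^ t)) B := by
    have h0 : Tendsto (fun n => (ν.bind ⇑(κ ^ n)) B) atTop (𝓝 0) :=
      tendsto_of_tendsto_of_tendsto_of_le_of_le tendsto_const_nhds hlim (fun _ => zero_le)
        fun n => measure_mono hBΔ
    have h1 := (ENNReal.tendsto_nat_tsum fun t => (η.bind ⇑(κ ^ t)) B).add h0
    simp_rw [← Measure.apply_eq_sum_add_bind_pow κ hΔ hcl hν hB hBΔ, add_zero] at h1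
    exact tendsto_nhds_unique tendsto_const_nhds h1
  ext B hB
  have hr : ν = ν.restrict Δᶜ := by
    nth_rw 2 [hν]
    rw [Measure.restrict_restrict hΔ.compl, Set.inter_self]
    exact hν
  rw [hr, Measure.restrict_apply hB, main (hB.inter hΔ.compl) Set.inter_subset_right,
    Measure.sum_apply _ hB]
  exact tsum_congr fun t => (Measure.restrict_apply hB).symm

/-! ### Disintegration, domination and switching policies -/

namespace ControlModel

variable {X A : Type*} [MeasurableSpace X] [MeasurableSpace A]
  (M : ControlModel X A) (η : Measure X)

instance (φ : M.StationaryPolicy) : IsMarkovKernel (M.stationaryKernel φ) := by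
  unfold stationaryKernel
  infer_instance

lemma bind_compProd_kernel (ν : Measure X) [SFinite ν] (φ : M.StationaryPolicy) :
    (ν ⊗ₘ φ.kernel).bind M.Q = ν.bind (M.stationaryKernel φ) := by
  ext B hB
  rw [Measure.bind_apply hB M.Q.aemeasurable, Measure.bind_apply hB (Kernel.aemeasurable _),
    Measure.lintegral_compProd (Kernel.measurable_coe _ hB)]
  exact lintegral_congr fun x => (M.stationaryKernel_apply φ x hB).symm

lemma stationaryKernel_compl_eq_zero {Δ : Set X} (hΔ : MeasurableSet Δ)
    (hcl : ∀ x ∈ Δ, ∀ a : A, M.Q (x, a) Δ = 1) (φ : M.StationaryPolicy) {x : X} (hx : x ∈ Δ) :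
    M.stationaryKernel φ x Δᶜ = 0 := by
  rw [stationaryKernel_apply _ _ _ hΔ.compl]
  simp [(prob_compl_eq_zero_iff hΔ).2 (hcl x hx _)]

lemma fst_pairLaw_zero [IsProbabilityMeasure η] (π : M.Policy) : (M.pairLaw η π 0).fst = η := by
  rw [pairLaw_zero, initialLaw, Measure.fst_compProd]

lemma fst_pairLaw_markovPolicy_succ [IsProbabilityMeasure η] (σ : ℕ → M.StationaryPolicy) (n : ℕ) :
    (M.pairLaw η (markovPolicy σ) (n + 1)).fst =
      (M.pairLaw η (markovPolicy σ) n).fst.bind (M.stationaryKernel (σ n)) := by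
  rw [fst_pairLaw_succ, pairLaw_markovPolicy, bind_compProd_kernel, ← pairLaw_markovPolicy]

lemma fst_pairLaw_markovPolicy_add [IsProbabilityMeasure η] {σ : ℕ → M.StationaryPolicy}
    {φ : M.StationaryPolicy} {k n : ℕ} (h : ∀ t, k ≤ t → t < k + n → σ t = φ) :
    (M.pairLaw η (markovPolicy σ) (k + n)).fst =
      (M.pairLaw η (markovPolicy σ) k).fst.bind ⇑(M.stationaryKernel φ ^ n) := by
  induction n with
  | zero => exact (Measure.bind_kernel_pow_zero _ _).symm
  | succ n ih =>
    rw [Measure.bind_kernel_pow_succ, ← ih fun t ht ht' => h t ht (by omega), ← add_assoc,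
      fst_pairLaw_markovPolicy_succ, h (k + n) (by omega) (by omega)]

/-- A measure carried by the graph disintegrates along a stationary policy. -/
lemma exists_eq_compProd [StandardBorelSpace A] {μ : Measure (X × A)}
    [IsFiniteMeasure μ] (hμ : μ M.graphᶜ = 0) (ξ : M.StationaryPolicy) :
    ∃ φ : M.StationaryPolicy, μ = μ.fst ⊗ₘ φ.kernel := by
  classical
  rcases isEmpty_or_nonempty X with hX | ⟨⟨x₀⟩⟩
  · exact ⟨ξ, by rw [Measure.eq_zero_of_isEmpty μ]; simp⟩
  have : Nonempty A := (M.admissible_nonempty x₀).to_type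
  -- The conditional kernel is admissible only almost everywhere; `ξ` replaces it on the exceptional
  -- set.
  let s : Set X := {x | μ.condKernel x (M.admissible x) = 1}
  have hs : MeasurableSet s :=
    (Kernel.measurable_kernel_prodMk_left (κ := μ.condKernel) M.measurableSet_graph)
      (measurableSet_singleton 1)
  refine ⟨⟨Kernel.piecewise hs μ.condKernel ξ.kernel, inferInstance, fun x => ?_⟩, ?_⟩
  · rw [Kernel.piecewise_apply]
    split_ifs with h
    exacts [h, ξ.admissible x]
  · conv_lhs => rw [← μ.disintegrate μ.condKernel]
    refine Measure.compProd_congr ?_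
    have h1 : ∀ᵐ q ∂(μ.fst ⊗ₘ μ.condKernel), q ∈ M.graph := by
      rw [μ.disintegrate]
      exact hμ
    filter_upwards [Measure.ae_ae_of_ae_compProd h1] with x hx
    have hxs : x ∈ s := (prob_compl_eq_zero_iff (M.measurableSet_admissible x)).1 hx
    rw [Kernel.piecewise_apply, if_pos hxs]

/-- A null set at time `t + 1` is `Q_ξ`-null from almost every state at time `t`, hence null for
each feasible action there; the pair law charges only feasible pairs. -/
lemma fst_pairLaw_absolutelyContinuous [IsProbabilityMeasure η] {ξ : M.StationaryPolicy}
    (hξ : M.IsDominating ξ) (π : M.Policy) (t : ℕ) :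
    (M.pairLaw η π t).fst ≪ η.bind ⇑(M.stationaryKernel ξ ^ t) := by
  induction t with
  | zero =>
    rw [Measure.bind_kernel_pow_zero, fst_pairLaw_zero]
  | succ t ih =>
    refine Measure.AbsolutelyContinuous.mk fun B hB h0 => ?_
    rw [Measure.bind_kernel_pow_succ, Measure.bind_apply hB (Kernel.aemeasurable _),
      lintegral_eq_zero_iff (Kernel.measurable_coe _ hB)] at h0
    rw [fst_pairLaw_succ, Measure.bind_apply hB M.Q.aemeasurable]
    refine lintegral_eq_zero_of_ae_eq_zero ?_
    have hK : ∀ᵐ q ∂(M.pairLaw η π t), q ∈ M.graph := M.pairLaw_compl_graph η π t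
    filter_upwards [hK, ae_of_ae_map measurable_fst.aemeasurable (ih.ae_le h0)] with q hq hq'
    exact hξ q.1 q.2 hq hq'

/-- All weights are positive, so the null sets do not depend on `β`. -/
lemma discountedLaw_apply_eq_zero_iff (ξ : M.StationaryPolicy) {β : ℝ} (h0 : 0 < β) (h1 : β < 1)
    {B : Set X} (hB : MeasurableSet B) :
    M.discountedLaw η ξ β B = 0 ↔ ∀ k, (η.bind ⇑(M.stationaryKernel ξ ^ k)) B = 0 := by
  simp [discountedLaw, Measure.sum_apply _ hB, h1.not_ge, (pow_pos h0 _).not_ge]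

/-- From almost every state visited by `ξ`, the stationary policy `φ` spends a finite expected time
off `Δ`: otherwise switching from `ξ` to `φ` would give an infinite expected hitting time. -/
lemma ae_tsum_pow_ne_top [IsProbabilityMeasure η] {Δ : Set X} (hΔ : MeasurableSet Δ)
    (habs : M.IsAbsorbing η Δ) (ξ φ : M.StationaryPolicy) (k : ℕ) :
    ∀ᵐ x ∂(η.bind ⇑(M.stationaryKernel ξ ^ k)),
      ∑' n, (M.stationaryKernel φ ^ n) x Δᶜ ≠ ∞ := by
  let σ : ℕ → M.StationaryPolicy := fun t => if t < k then ξ else φ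
  have hk : (M.pairLaw η (markovPolicy σ) k).fst = η.bind ⇑(M.stationaryKernel ξ ^ k) := by
    have := M.fst_pairLaw_markovPolicy_add η (σ := σ) (φ := ξ) (k := 0) (n := k)
      fun t _ ht => if_pos (by omega)
    rwa [zero_add, fst_pairLaw_zero] at this
  have hkn (n : ℕ) := M.fst_pairLaw_markovPolicy_add η (σ := σ) (φ := φ) (k := k) (n := n)
      fun t ht _ => if_neg (by omega)
  have hfin := habs.2 (markovPolicy σ)
  rw [M.lintegral_hittingTime η hΔ habs.1] at hfin
  -- Only the times from the switch onward are kept; their sum is the integral of the expected time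
  -- off `Δ` under `φ`.
  have hle : ∑' n, (M.pairLaw η (markovPolicy σ) (k + n)).fst Δᶜ ≤
      ∑' t, (M.pairLaw η (markovPolicy σ) t).fst Δᶜ :=
    ENNReal.tsum_comp_le_tsum_of_injective (add_right_injective k) _
  have hm (n : ℕ) : Measurable fun x => (M.stationaryKernel φ ^ n) x Δᶜ :=
    Kernel.measurable_coe _ hΔ.compl
  simp_rw [hkn, hk, fun n : ℕ => Measure.bind_apply (m := η.bind ⇑(M.stationaryKernel ξ ^ k)) hΔ.compl
    (M.stationaryKernel φ ^ n).aemeasurable] at hle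
  rw [← lintegral_tsum fun n => (hm n).aemeasurable] at hle
  filter_upwards [ae_lt_top (Measurable.tsum hm) (hle.trans_lt hfin).ne] with x hx
    using hx.ne

/-- The occupation measure of a stationary policy. -/
lemma occupationMeasure_markovPolicy_const [IsProbabilityMeasure η] {Δ : Set X}
    (hΔ : MeasurableSet Δ) (hcl : ∀ x ∈ Δ, ∀ a : A, M.Q (x, a) Δ = 1) (φ : M.StationaryPolicy) :
    M.occupationMeasure η Δ (markovPolicy fun _ => φ) =
      (Measure.sum fun t => (η.bind ⇑(M.stationaryKernel φ ^ t)).restrict Δᶜ) ⊗ₘ φ.kernel := by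
  have := (M.stationaryKernel φ).isMarkovKernel_pow
  rw [M.occupationMeasure_eq_sum η hΔ hcl, Measure.compProd_sum_left]
  congr 1
  ext1 t
  rw [Measure.restrict_compProd _ _ hΔ.compl, M.pairLaw_markovPolicy]
  have := M.fst_pairLaw_markovPolicy_add η (σ := fun _ => φ) (φ := φ) (k := 0) (n := t)
    fun _ _ _ => rfl
  rw [zero_add, fst_pairLaw_zero] at this
  rw [this]

end ControlModel

/-! ### The characterization -/

theorem theorem4p5 {X A : Type*} [MeasurableSpace X]
    [TopologicalSpace A] [TopologicalSpace.MetrizableSpace A] [SecondCountableTopology A]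
    [MeasurableSpace A] [BorelSpace A] [StandardBorelSpace A]
    (M : ControlModel X A) (η : Measure X) [IsProbabilityMeasure η]
    (Δ : Set X) (hΔ : MeasurableSet Δ)
    (habs : M.IsAbsorbing η Δ) (hS : M.ConditionS) :
    (∃ ξ : M.StationaryPolicy, M.IsDominating ξ) ∧
    ∀ ξ : M.StationaryPolicy, M.IsDominating ξ →
      ∀ β : ℝ, 0 < β → β < 1 →
        ∀ μ ∈ M.characteristicSolutions η Δ,
          μ ∈ M.occupationMeasures η Δ ↔ μ.fst ≪ M.discountedLaw η ξ β := by
  refine ⟨hS.exists_isDominating, fun ξ hξ β h0 h1 μ ⟨hμ, hμK, hμX⟩ => ⟨?_, fun hac => ?_⟩⟩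
  · rintro ⟨π, rfl⟩
    refine Measure.AbsolutelyContinuous.mk fun B hB hB0 => ?_
    rw [M.discountedLaw_apply_eq_zero_iff η ξ h0 h1 hB] at hB0
    rw [M.occupationMeasure_eq_sum η hΔ habs.1, Measure.fst_apply hB,
      Measure.sum_apply _ (measurable_fst hB), ENNReal.tsum_eq_zero]
    intro t
    refine le_antisymm ((Measure.restrict_le_self _).trans_eq ?_) zero_le
    rw [← Measure.fst_apply hB]
    exact M.fst_pairLaw_absolutelyContinuous η hξ π t (hB0 t)
  · obtain ⟨φ, hφ⟩ := M.exists_eq_compProd hμK ξ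
    have hbind : μ.bind M.Q = μ.fst.bind (M.stationaryKernel φ) := by
      conv_lhs => rw [hφ]
      exact M.bind_compProd_kernel μ.fst φ
    rw [hbind] at hμX
    have hm : MeasurableSet {x | ∑' n, (M.stationaryKernel φ ^ n) x Δᶜ ≠ ∞} :=
      (Measurable.tsum fun n => Kernel.measurable_coe _ hΔ.compl)
        (measurableSet_singleton ∞).compl
    -- Absolute continuity enters only here.
    have hfin : ∀ᵐ x ∂μ.fst, ∑' n, (M.stationaryKernel φ ^ n) x Δᶜ ≠ ∞ :=
      hac.ae_le ((M.discountedLaw_apply_eq_zero_iff η ξ h0 h1 hm.compl).2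
        (M.ae_tsum_pow_ne_top η hΔ habs ξ φ))
    refine ⟨ControlModel.markovPolicy fun _ => φ, ?_⟩
    rw [M.occupationMeasure_markovPolicy_const η hΔ habs.1, ← Measure.eq_sum_bind_pow _ hΔ
      (fun x hx => M.stationaryKernel_compl_eq_zero hΔ habs.1 φ hx) hμX hfin, ← hφ]
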